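/- Identify $M_2(\mathbb C)\otimes M_2(\mathbb C)\otimes M_2(\mathbb C)$ with $M_8(\mathbb C)$ through the lexicographic order of the basis indices $000,001,\dots,111$. A three-qubit state is a positive semidefinite matrix $\varrho\in M_8(\mathbb C)$ of trace one; it is separable if it is a convex combination of pure product states, that is, of matrices $\psi_1\psi_1^*\otimes\psi_2\psi_2^*\otimes\psi_3\psi_3^*$ with unit vectors $\psi_1,\psi_2,\psi_3\in\mathbb C^2$. For $a,b\in\mathbb R^4$ and $c\in\mathbb C^4$ let $X(a,b,c)$ be the self-adjoint $8\times 8$ matrix with diagonal $(a_1,a_2,a_3,a_4,b_4,b_3,b_2,b_1)$, with anti-diagonal, read from the first row to the last, $(c_1,c_2,c_3,c_4,\bar c_4,\bar c_3,\bar c_2,\bar c_1)$, and with all other entries zero. Theorem. Let $\varrho=X(a,b,c)$ be a three-qubit state. Then $\varrho$ is separable if and only if $$C(z)\,\Delta_\varrho\ \ge\ \mathrm{Re}\,(z_1c_1+z_2c_2+z_3c_3+z_4\bar c_4)\qquad\text{for every } z\in\mathbb C^4,$$ where $$\Delta_\varrho=\min\bigl\{\sqrt{a_1b_1},\sqrt{a_2b_2},\sqrt{a_3b_3},\sqrt{a_4b_4},\sqrt[4]{a_1b_2b_3a_4},\sqrt[4]{b_1a_2a_3b_4}\bigr\}$$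 and $$C(z)=\sup_{\alpha,\beta,\gamma\in\mathbb R}\bigl|\mathrm{Re}\bigl(z_1e^{\mathrm i(\alpha+\beta+\gamma)}+z_2e^{\mathrm i\alpha}+z_3e^{\mathrm i\beta}+z_4e^{\mathrm i\gamma}\bigr)\bigr|.$$ -/

import Mathlib

open scoped Kronecker ComplexOrder

noncomputable section

namespace ThreeQubit

/-- Index set of the computational basis of `ℂ² ⊗ ℂ² ⊗ ℂ²`. -/
abbrev Idx : Type := Fin 2 × Fin 2 × Fin 2

/-- The lexicographic enumeration `(i, j, k) ↦ 4 i + 2 j + k` of the basis indices. -/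
def lex : Idx ≃ Fin 8 :=
  (Equiv.prodCongr (Equiv.refl (Fin 2)) finProdFinEquiv).trans finProdFinEquiv

/-- A state is a density matrix: positive semidefinite of trace one. -/
def IsState {n : Type*} [Fintype n] (ρ : Matrix n n ℂ) : Prop :=
  ρ.PosSemidef ∧ ρ.trace = 1

/-- A pure state is the rank one projection `ψ ψ*` onto a unit vector `ψ`. -/
def IsPureState {n : Type*} [Fintype n] (ρ : Matrix n n ℂ) : Prop :=
  ∃ ψ : n → ℂ, star ψ ⬝ᵥ ψ = 1 ∧ ρ = Matrix.vecMulVec ψ (star ψ)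

/-- The pure product states of three qubits: tensor (Kronecker) products of three pure
one-qubit states. -/
def pureProductStates : Set (Matrix Idx Idx ℂ) :=
  {ρ | ∃ A B C : Matrix (Fin 2) (Fin 2) ℂ,
    IsPureState A ∧ IsPureState B ∧ IsPureState C ∧ ρ = A ⊗ₖ (B ⊗ₖ C)}

/-- A three-qubit matrix is separable if it is a convex combination of pure product states. -/
def IsSeparable (ρ : Matrix Idx Idx ℂ) : Prop :=
  ρ ∈ convexHull ℝ pureProductStates

/-- The self-adjoint X-shaped `8 × 8` matrix; rows and columns are numbered lexicographically. -/
def xMatrix8 (a b : Fin 4 → ℝ) (c : Fin 4 → ℂ) : Matrix (Fin 8) (Fin 8) ℂ :=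
  !![(a 0 : ℂ), 0, 0, 0, 0, 0, 0, c 0;
     0, (a 1 : ℂ), 0, 0, 0, 0, c 1, 0;
     0, 0, (a 2 : ℂ), 0, 0, c 2, 0, 0;
     0, 0, 0, (a 3 : ℂ), c 3, 0, 0, 0;
     0, 0, 0, star (c 3), (b 3 : ℂ), 0, 0, 0;
     0, 0, star (c 2), 0, 0, (b 2 : ℂ), 0, 0;
     0, star (c 1), 0, 0, 0, 0, (b 1 : ℂ), 0;
     star (c 0), 0, 0, 0, 0, 0, 0, (b 0 : ℂ)]

/-- `X(a, b, c)` as an operator on three qubits. -/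
def X (a b : Fin 4 → ℝ) (c : Fin 4 → ℂ) : Matrix Idx Idx ℂ :=
  (xMatrix8 a b c).submatrix lex lex

/-- `Δ = min {√(aᵢ bᵢ), (a₁ b₂ b₃ a₄)^(1/4), (b₁ a₂ a₃ b₄)^(1/4)}`, used for nonnegative
`a` and `b` (the entries are numbered from `0` here). -/
def Delta (a b : Fin 4 → ℝ) : ℝ :=
  min (⨅ i : Fin 4, √(a i * b i))
    (min ((a 0 * b 1 * b 2 * a 3) ^ (1 / 4 : ℝ)) ((b 0 * a 1 * a 2 * b 3) ^ (1 / 4 : ℝ)))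

/-- `𝓛(ϱ, z) = Re (z₁ c₁ + z₂ c₂ + z₃ c₃ + z₄ c̄₄)`. -/
def L (c z : Fin 4 → ℂ) : ℝ :=
  (z 0 * c 0 + z 1 * c 1 + z 2 * c 2 + z 3 * star (c 3)).re

/-- The quantity `C(z)`: the supremum, over all real angles `(α, β, γ) = (t.1, t.2.1, t.2.2)`, of a
trigonometric polynomial that is bounded by `2 ∑ ‖zᵢ‖`. -/
def C (z : Fin 4 → ℂ) : ℝ :=
  ⨆ t : ℝ × ℝ × ℝ,
    |(z 0).re * Real.cos (t.1 + t.2.1 + t.2.2) - (z 0).im * Real.sin (t.1 + t.2.1 + t.2.2)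
      + (z 1).re * Real.cos t.1 - (z 1).im * Real.sin t.1
      + (z 2).re * Real.cos t.2.1 - (z 2).im * Real.sin t.2.1
      + (z 3).re * Real.cos t.2.2 - (z 3).im * Real.sin t.2.2|

end ThreeQubit

end

/-! `C` is the support function of the torus of points (e^{i(α+β+γ)}, e^{iα}, e^{iβ}, e^{iγ}) in ℂ⁴,
which is symmetric under v ↦ -v. By Hahn–Banach the inequality therefore says that c, with its last
coordinate conjugated, lies in Δ times the convex hull of the torus (`mem_smul_convexHull_torus`).

Sufficiency: averaging a product vector over sign flips leaves an X-matrix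
(`X_mem_sepCone_of_product`). This realises each torus point as anti-diagonal over the diagonal
e^{sᵢ}, e^{-sᵢ} whenever s₀ + s₃ = s₁ + s₂. The bounds defining Δ are what is needed to fit Δ times
such a diagonal below (a, b); the surplus is a nonnegative diagonal matrix, which lies in the cone.

Necessity: pure product states satisfy the geometric-mean bounds with equality, with anti-diagonal a
multiple of a torus point. Geometric means are superadditive, so the bounds survive convex
combinations (`convex_xBoundSet`). -/

namespace ThreeQubit

open Complex

/-! ### The cone of pure product states -/

/-- The convex cone generated by the pure product states. -/
noncomputable def sepCone : Submodule NNReal (Matrix Idx Idx ℂ) :=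
  Submodule.span NNReal pureProductStates

/-- The (unnormalised) rank one matrix `x x*`. -/
noncomputable def ketbra {n : Type*} (x : n → ℂ) : Matrix n n ℂ := Matrix.vecMulVec x (star x)

lemma smul_mem_sepCone {r : ℝ} (hr : 0 ≤ r) {M : Matrix Idx Idx ℂ} (hM : M ∈ sepCone) :
    r • M ∈ sepCone :=
  sepCone.smul_mem ⟨r, hr⟩ hM

lemma trace_ketbra {n : Type*} [Fintype n] (x : n → ℂ) :
    (ketbra x).trace = star x ⬝ᵥ x := by
  rw [ketbra, Matrix.trace_vecMulVec, dotProduct_comm]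

lemma trace_eq_one_of_mem {M : Matrix Idx Idx ℂ} (hM : M ∈ convexHull ℝ pureProductStates) :
    M.trace = 1 := by
  have hconv : Convex ℝ {M : Matrix Idx Idx ℂ | M.trace = 1} := by
    intro A hA B hB s t _ _ hst
    simp only [Set.mem_ofPred_eq] at *
    rw [Matrix.trace_add, Matrix.trace_smul, Matrix.trace_smul, hA, hB, ← add_smul, hst, one_smul]
  refine convexHull_min ?_ hconv hM
  rintro _ ⟨_, _, _, ⟨x, hx, rfl⟩, ⟨y, hy, rfl⟩, ⟨z, hz, rfl⟩, rfl⟩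
  have h := trace_ketbra x
  have h' := trace_ketbra y
  have h'' := trace_ketbra z
  rw [ketbra] at h h' h''
  simp [Matrix.trace_kronecker, h, h', h'', hx, hy, hz]

lemma exists_ketbra_eq_smul {n : Type*} [Fintype n] [Nonempty n] [DecidableEq n] (x : n → ℂ) :
    ∃ r : ℝ, 0 ≤ r ∧ ∃ A : Matrix n n ℂ, IsPureState A ∧ ketbra x = r • A := by
  by_cases hx : x = 0
  · obtain ⟨i⟩ := ‹Nonempty n›
    refine ⟨0, le_rfl, _, ⟨Pi.single i 1, by simp, rfl⟩, ?_⟩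
    ext
    simp [hx, ketbra, Matrix.vecMulVec_apply]
  · have hpos : 0 < ∑ i, normSq (x i) := by
      obtain ⟨i, hi⟩ := Function.ne_iff.mp hx
      exact Finset.sum_pos' (fun _ _ => normSq_nonneg _) ⟨i, Finset.mem_univ _, normSq_pos.mpr hi⟩
    set r := ∑ i, normSq (x i) with hr
    have hr0 : ((√r : ℝ) : ℂ) ≠ 0 := by exact_mod_cast (Real.sqrt_pos.mpr hpos).ne'
    have hrr : ((√r : ℝ) : ℂ) * (√r : ℝ) = r := by
      exact_mod_cast Real.mul_self_sqrt hpos.le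
    have hxx : star x ⬝ᵥ x = (r : ℂ) := by
      simp [dotProduct, hr, normSq_eq_conj_mul_self]
    refine ⟨r, hpos.le, _, ⟨((√r : ℝ) : ℂ)⁻¹ • x, ?_, rfl⟩, ?_⟩
    · rw [star_smul, smul_dotProduct, dotProduct_smul, hxx]
      simp only [smul_eq_mul, star_def, map_inv₀, conj_ofReal]
      field_simp
      rw [← hrr]; ring
    · ext i j
      simp only [ketbra, Matrix.vecMulVec_apply, Matrix.smul_apply, Pi.smul_apply, Pi.star_apply,
        smul_eq_mul, star_mul', star_def, map_inv₀, conj_ofReal, real_smul]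
      field_simp
      rw [← hrr]; ring

lemma kronecker_ketbra_mem_sepCone (x y z : Fin 2 → ℂ) :
    ketbra x ⊗ₖ (ketbra y ⊗ₖ ketbra z) ∈ sepCone := by
  obtain ⟨r, hr, A, hA, hxA⟩ := exists_ketbra_eq_smul x
  obtain ⟨s, hs, B, hB, hyB⟩ := exists_ketbra_eq_smul y
  obtain ⟨t, ht, D, hD, hzD⟩ := exists_ketbra_eq_smul z
  have h : ketbra x ⊗ₖ (ketbra y ⊗ₖ ketbra z) = (r * (s * t)) • (A ⊗ₖ (B ⊗ₖ D)) := by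
    rw [hxA, hyB, hzD]
    ext ⟨i, j, k⟩ ⟨i', j', k'⟩
    simp only [Matrix.kronecker_apply, Matrix.smul_apply, real_smul, ofReal_mul]
    ring
  rw [h]
  exact smul_mem_sepCone (by positivity) (Submodule.subset_span ⟨A, B, D, hA, hB, hD, rfl⟩)

lemma pureProductStates_nonempty : pureProductStates.Nonempty := by
  have h : IsPureState (Matrix.vecMulVec (Pi.single (0 : Fin 2) (1 : ℂ)) (star (Pi.single 0 1))) :=
    ⟨_, by simp, rfl⟩
  exact ⟨_, _, _, _, h, h, h, rfl⟩

lemma exists_smul_of_mem_sepCone {M : Matrix Idx Idx ℂ} (hM : M ∈ sepCone) :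
    ∃ r : ℝ, 0 ≤ r ∧ ∃ S ∈ convexHull ℝ pureProductStates, M = r • S := by
  induction hM using Submodule.span_induction with
  | mem x hx => exact ⟨1, zero_le_one, x, subset_convexHull ℝ _ hx, (one_smul ℝ x).symm⟩
  | zero =>
    obtain ⟨x, hx⟩ := pureProductStates_nonempty
    exact ⟨0, le_rfl, x, subset_convexHull ℝ _ hx, (zero_smul ℝ x).symm⟩
  | smul t x _ ih =>
    obtain ⟨r, hr, S, hS, rfl⟩ := ih
    exact ⟨t * r, by positivity, S, hS, by rw [mul_smul]; rfl⟩
  | add x y _ _ ihx ihy =>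
    obtain ⟨r, hr, S, hS, rfl⟩ := ihx
    obtain ⟨s, hs, T, hT, rfl⟩ := ihy
    rcases (add_nonneg hr hs).eq_or_lt with h | h
    · obtain rfl : r = 0 := by linarith
      obtain rfl : s = 0 := by linarith
      exact ⟨0, le_rfl, S, hS, by simp⟩
    · refine ⟨r + s, h.le, (r / (r + s)) • S + (s / (r + s)) • T,
        convex_convexHull ℝ _ hS hT (by positivity) (by positivity) (by field_simp), ?_⟩
      rw [smul_add, smul_smul, smul_smul]
      congr 2 <;> field_simp

/-- Pure product states have trace one, so the trace condition forces the scalar in front of the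
hull element to be one. Normalisation can thus be ignored inside the cone. -/
lemma isSeparable_of_mem_sepCone {M : Matrix Idx Idx ℂ} (hM : M ∈ sepCone) (htr : M.trace = 1) :
    IsSeparable M := by
  obtain ⟨r, -, S, hS, rfl⟩ := exists_smul_of_mem_sepCone hM
  rw [Matrix.trace_smul, trace_eq_one_of_mem hS, real_smul, mul_one] at htr
  obtain rfl : r = 1 := by exact_mod_cast htr
  rwa [one_smul]

/-! ### X-matrices in the cone -/

/-- The diagonal of `X a b c`. -/
def diagonalEntry (a b : Fin 4 → ℝ) : Fin 2 → Fin 2 → Fin 2 → ℝ :=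
  ![![![a 0, a 1], ![a 2, a 3]], ![![b 3, b 2], ![b 1, b 0]]]

/-- The anti-diagonal of `X a b c`. -/
def antidiagonalEntry (c : Fin 4 → ℂ) : Fin 2 → Fin 2 → Fin 2 → ℂ :=
  ![![![c 0, c 1], ![c 2, c 3]], ![![star (c 3), star (c 2)], ![star (c 1), star (c 0)]]]

lemma X_apply (a b : Fin 4 → ℝ) (c : Fin 4 → ℂ) : ∀ i j k i' j' k' : Fin 2,
    X a b c (i, j, k) (i', j', k') =
      if i = i' ∧ j = j' ∧ k = k' then (diagonalEntry a b i j k : ℂ)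
      else if i ≠ i' ∧ j ≠ j' ∧ k ≠ k' then antidiagonalEntry c i j k else 0 := by
  intro i j k i' j' k'
  have h1 : lex (i, j, k) = ![![![0, 1], ![2, 3]], ![![4, 5], ![6, 7]]] i j k := by
    revert i j k; decide
  have h2 : lex (i', j', k') = ![![![0, 1], ![2, 3]], ![![4, 5], ![6, 7]]] i' j' k' := by
    revert i' j' k'; decide
  rw [X, Matrix.submatrix_apply, h1, h2]
  clear h1 h2
  revert i j k i' j' k'
  simp only [Fin.forall_fin_two]
  simp [xMatrix8, diagonalEntry, antidiagonalEntry]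

/-- Averaging a product vector over an even number of sign flips leaves only the X-part. -/
lemma X_mem_sepCone_of_product (x y z : Fin 2 → ℂ) :
    X ![normSq (x 0) * normSq (y 0) * normSq (z 0), normSq (x 0) * normSq (y 0) * normSq (z 1),
        normSq (x 0) * normSq (y 1) * normSq (z 0), normSq (x 0) * normSq (y 1) * normSq (z 1)]
      ![normSq (x 1) * normSq (y 1) * normSq (z 1), normSq (x 1) * normSq (y 1) * normSq (z 0),
        normSq (x 1) * normSq (y 0) * normSq (z 1), normSq (x 1) * normSq (y 0) * normSq (z 0)]
      ![x 0 * star (x 1) * (y 0 * star (y 1)) * (z 0 * star (z 1)),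
        x 0 * star (x 1) * (y 0 * star (y 1)) * (z 1 * star (z 0)),
        x 0 * star (x 1) * (y 1 * star (y 0)) * (z 0 * star (z 1)),
        x 0 * star (x 1) * (y 1 * star (y 0)) * (z 1 * star (z 0))] ∈ sepCone := by
  -- A flip multiplies an entry by -1 for each flipped qubit whose row and column indices differ.
  -- Over the four even flips these signs cancel if one or two qubits differ, and are all 1 if none
  -- or all three do.
  have key : ∀ M : Matrix Idx Idx ℂ, M = (1 / 4 : ℝ) •
      (ketbra x ⊗ₖ (ketbra y ⊗ₖ ketbra z)
      + ketbra ![x 0, -x 1] ⊗ₖ (ketbra ![y 0, -y 1] ⊗ₖ ketbra z)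
      + ketbra ![x 0, -x 1] ⊗ₖ (ketbra y ⊗ₖ ketbra ![z 0, -z 1])
      + ketbra x ⊗ₖ (ketbra ![y 0, -y 1] ⊗ₖ ketbra ![z 0, -z 1])) → M ∈ sepCone := by
    rintro _ rfl
    refine smul_mem_sepCone (by norm_num) ?_
    refine add_mem (add_mem (add_mem ?_ ?_) ?_) ?_ <;> exact kronecker_ketbra_mem_sepCone _ _ _
  apply key
  ext ⟨i, j, k⟩ ⟨i', j', k'⟩
  rw [X_apply]
  simp only [ketbra, Matrix.smul_apply, Matrix.add_apply, Matrix.kronecker_apply,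
    Matrix.vecMulVec_apply, Pi.star_apply]
  revert i j k i' j' k'
  simp only [Fin.forall_fin_two]
  simp [diagonalEntry, antidiagonalEntry, normSq_eq_conj_mul_self]
  refine ⟨⟨⟨?_, ?_⟩, ?_, ?_⟩, ⟨?_, ?_⟩, ?_, ?_⟩
  all_goals ring_nf
  all_goals simp

lemma ketbra_single_apply (p i j : Fin 2) :
    ketbra (Pi.single p (1 : ℂ)) i j = if i = p ∧ j = p then 1 else 0 := by
  by_cases hi : i = p <;> by_cases hj : j = p <;>
    simp [ketbra, Matrix.vecMulVec_apply, hi, hj]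

lemma X_diagonal_mem_sepCone {a b : Fin 4 → ℝ} (ha : ∀ i, 0 ≤ a i) (hb : ∀ i, 0 ≤ b i) :
    X a b 0 ∈ sepCone := by
  have key : ∀ M : Matrix Idx Idx ℂ, (∃ d : Idx → ℝ, (∀ p, 0 ≤ d p) ∧ M = ∑ p, d p •
      (ketbra (Pi.single p.1 1) ⊗ₖ (ketbra (Pi.single p.2.1 1) ⊗ₖ ketbra (Pi.single p.2.2 1))))
      → M ∈ sepCone := by
    rintro _ ⟨d, hd, rfl⟩
    exact sum_mem fun p _ => smul_mem_sepCone (hd p) (kronecker_ketbra_mem_sepCone _ _ _)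
  refine key _ ⟨fun p => (X a b 0 p p).re, ?_, ?_⟩
  · rintro ⟨i, j, k⟩
    beta_reduce
    rw [X_apply]
    revert i j k
    simp [Fin.forall_fin_two, diagonalEntry, ha, hb]
  · ext ⟨i, j, k⟩ ⟨i', j', k'⟩
    simp only [Matrix.sum_apply, Matrix.smul_apply, Matrix.kronecker_apply, ketbra_single_apply]
    have hz : antidiagonalEntry 0 i j k = 0 := by
      revert i j k
      simp [Fin.forall_fin_two, antidiagonalEntry]
    rw [Finset.sum_eq_single (i, j, k)]
    · rw [X_apply, X_apply, hz]
      by_cases h : i = i' ∧ j = j' ∧ k = k'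
      · obtain ⟨rfl, rfl, rfl⟩ := h
        simp
      · rw [if_neg h, ite_self]
        by_cases hi : i' = i
        · by_cases hj : j' = j
          · have hk : k' ≠ k := fun hk => h ⟨hi.symm, hj.symm, hk.symm⟩
            simp [hk]
          · simp [hj]
        · simp [hi]
    · rintro ⟨p, q, r⟩ - h
      by_cases hi : i = p
      · by_cases hj : j = q
        · have hk : k ≠ r := fun hk => h (by rw [hi, hj, hk])
          simp [hk]
        · simp [hj]
      · simp [hi]
    · simp

/-! ### Carathéodory and compactness -/

/-- The convex hull of a compact set in a finite-dimensional space is compact. -/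
theorem isCompact_convexHull_of_finiteDimensional {E : Type*} [NormedAddCommGroup E]
    [NormedSpace ℝ E] [FiniteDimensional ℝ E] {s : Set E} (hs : IsCompact s) :
    IsCompact (convexHull ℝ s) := by
  rcases s.eq_empty_or_nonempty with rfl | ⟨x₀, hx₀⟩
  · simp
  -- By Carathéodory, dim + 1 points suffice, so the hull is a continuous image of simplex × sᴺ.
  -- Shorter combinations are padded with weight 0 at `x₀`.
  set N := Module.finrank ℝ E + 1
  set K : Set ((Fin N → ℝ) × (Fin N → E)) := stdSimplex ℝ (Fin N) ×ˢ Set.univ.pi fun _ => s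
  have hK : IsCompact K :=
    (isCompact_stdSimplex ℝ (Fin N)).prod (isCompact_univ_pi fun _ => hs)
  have hf : Continuous fun p : (Fin N → ℝ) × (Fin N → E) => ∑ i, p.1 i • p.2 i := by fun_prop
  convert hK.image hf using 1
  ext x
  constructor
  · intro hx
    obtain ⟨ι, _, z, w, hz, hind, hpos, hsum, rfl⟩ := eq_pos_convex_span_of_mem_convexHull hx
    have hcard : Fintype.card ι ≤ Fintype.card (Fin N) := by
      rw [Fintype.card_fin]
      refine hind.card_le_finrank_succ.trans ?_
      exact Nat.succ_le_succ (Submodule.finrank_le _)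
    obtain ⟨e⟩ := Function.Embedding.nonempty_of_card_le hcard
    have hw : ∀ i, Function.extend e w (0 : Fin N → ℝ) (e i) = w i := fun i => e.injective.extend_apply w (0 : Fin N → ℝ) i
    have hw' : ∀ j ∉ Set.range e, Function.extend e w (0 : Fin N → ℝ) j = 0 := fun j hj =>
      Function.extend_apply' w (0 : Fin N → ℝ) j hj
    refine ⟨(Function.extend e w (0 : Fin N → ℝ), Function.extend e z fun _ => x₀), ⟨⟨fun j => ?_, ?_⟩, ?_⟩, ?_⟩
    · by_cases hj : j ∈ Set.range e
      · obtain ⟨i, rfl⟩ := hj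
        exact (hpos i).le.trans_eq (hw i).symm
      · exact (hw' j hj).ge
    · rw [← hsum]
      exact (Fintype.sum_of_injective e e.injective _ _ hw' fun i => (hw i).symm).symm
    · intro j _
      by_cases hj : j ∈ Set.range e
      · obtain ⟨i, rfl⟩ := hj
        simp only [e.injective.extend_apply]
        exact hz (Set.mem_range_self i)
      · simpa only [Function.extend_apply' _ _ j hj] using hx₀
    · refine (Fintype.sum_of_injective e e.injective _ _ (fun j hj => ?_) fun i => ?_).symm
      · simp only [hw' j hj, zero_smul]
      · simp only [hw, e.injective.extend_apply]
  · rintro ⟨⟨w, z⟩, ⟨⟨hw0, hw1⟩, hz⟩, rfl⟩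
    exact (convex_convexHull ℝ s).sum_mem (fun i _ => hw0 i) hw1
      fun i _ => subset_convexHull ℝ s (hz i (Set.mem_univ i))

/-! ### The torus and its support function -/

/-- The point of the three-dimensional torus in `ℂ⁴` with angles `t`. -/
noncomputable def torusPoint (t : ℝ × ℝ × ℝ) : Fin 4 → ℂ :=
  ![exp ((t.1 + t.2.1 + t.2.2 : ℝ) * I), exp ((t.1 : ℝ) * I), exp ((t.2.1 : ℝ) * I),
    exp ((t.2.2 : ℝ) * I)]

/-- The real pairing `Re ∑ zᵢ vᵢ`. -/
noncomputable def pairing (z v : Fin 4 → ℂ) : ℝ := (∑ i, z i * v i).re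

lemma C_eq (z : Fin 4 → ℂ) : C z = ⨆ t, |pairing z (torusPoint t)| := by
  unfold C
  congr 1
  ext t
  congr 1
  simp only [pairing, torusPoint, Fin.sum_univ_four, add_re, mul_re, exp_ofReal_mul_I_re,
    exp_ofReal_mul_I_im, Matrix.cons_val]
  ring

lemma norm_torusPoint (t : ℝ × ℝ × ℝ) (i : Fin 4) : ‖torusPoint t i‖ = 1 := by
  fin_cases i <;> exact norm_exp_ofReal_mul_I _

lemma abs_pairing_le_C (z : Fin 4 → ℂ) (t : ℝ × ℝ × ℝ) :
    |pairing z (torusPoint t)| ≤ C z := by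
  rw [C_eq]
  refine le_ciSup (f := fun t => |pairing z (torusPoint t)|) ⟨∑ i, ‖z i‖, ?_⟩ t
  rintro _ ⟨t, rfl⟩
  refine (abs_re_le_norm _).trans ((norm_sum_le _ _).trans (Finset.sum_le_sum fun i _ => ?_))
  rw [norm_mul, norm_torusPoint, mul_one]

/-- The shifts π, π, -π add up to π, so all four phases change sign. This symmetry makes the
absolute value in `C` harmless. -/
lemma torusPoint_add_pi (t : ℝ × ℝ × ℝ) :
    torusPoint (t.1 + Real.pi, t.2.1 + Real.pi, t.2.2 - Real.pi) = - torusPoint t := by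
  have h (x : ℝ) : exp ((x + Real.pi : ℝ) * I) = -exp (x * I) := by
    rw [ofReal_add, add_mul, exp_add, exp_pi_mul_I, mul_neg_one]
  have h' (x : ℝ) : exp ((x - Real.pi : ℝ) * I) = -exp (x * I) := by
    rw [← neg_neg (exp ((x - Real.pi : ℝ) * I)), ← h, sub_add_cancel]
  ext i
  fin_cases i
  · simp only [torusPoint, Pi.neg_apply]
    exact (congrArg (fun x : ℝ => exp (x * I)) (by ring)).trans (h (t.1 + t.2.1 + t.2.2))
  · exact h _
  · exact h _
  · exact h' _

/-- The space of angles is not compact, so the torus is parametrised by three copies of `Circle`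
instead. -/
lemma isCompact_range_torusPoint : IsCompact (Set.range torusPoint) := by
  have h : Set.range torusPoint = Set.range fun p : Circle × Circle × Circle =>
      ![(p.1 * p.2.1 * p.2.2 : ℂ), (p.1 : ℂ), (p.2.1 : ℂ), (p.2.2 : ℂ)] := by
    ext v
    constructor
    · rintro ⟨t, rfl⟩
      refine ⟨(Circle.exp t.1, Circle.exp t.2.1, Circle.exp t.2.2), ?_⟩
      simp [torusPoint, Circle.coe_exp, ← exp_add, add_mul]
    · rintro ⟨⟨p, q, r⟩, rfl⟩
      obtain ⟨α, rfl⟩ : ∃ x, Circle.exp x = p := ⟨_, Circle.exp_arg p⟩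
      obtain ⟨β, rfl⟩ : ∃ x, Circle.exp x = q := ⟨_, Circle.exp_arg q⟩
      obtain ⟨γ, rfl⟩ : ∃ x, Circle.exp x = r := ⟨_, Circle.exp_arg r⟩
      refine ⟨(α, β, γ), ?_⟩
      simp [torusPoint, Circle.coe_exp, ← exp_add, add_mul]
  rw [h]
  refine isCompact_range (continuous_pi fun i => ?_)
  fin_cases i <;> simp <;> fun_prop

lemma exists_pairing_eq (f : (Fin 4 → ℂ) →L[ℝ] ℝ) : ∃ z, ∀ v, f v = pairing z v := by
  refine ⟨fun i => f (Pi.single i 1) - f (Pi.single i I) * I, fun v => ?_⟩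
  have hv : v = ∑ i, ((v i).re • (Pi.single i 1 : Fin 4 → ℂ) + (v i).im • (Pi.single i I : Fin 4 → ℂ)) := by
    ext j
    simp only [Finset.sum_apply, Pi.add_apply, Pi.smul_apply]
    rw [Finset.sum_eq_single j (fun i _ hij => by simp [hij.symm]) (by simp)]
    simp [re_add_im]
  conv_lhs => rw [hv]
  simp only [map_sum, map_add, map_smul, pairing, re_sum]
  refine Finset.sum_congr rfl fun i _ => ?_
  simp
  ring

lemma pairing_smul (z v : Fin 4 → ℂ) (r : ℝ) : pairing z (r • v) = r * pairing z v := by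
  simp only [pairing, Fin.sum_univ_four, Pi.smul_apply, real_smul, mul_re, add_re, ofReal_re,
    ofReal_im, mul_im]
  ring

lemma pairing_add (z v w : Fin 4 → ℂ) : pairing z (v + w) = pairing z v + pairing z w := by
  simp [pairing, mul_add, Finset.sum_add_distrib]

open scoped Pointwise in
/-- The gauge inequality for all functionals puts `v` into the scaled hull of the torus. -/
lemma mem_smul_convexHull_torus {v : Fin 4 → ℂ} {r : ℝ} (hr : 0 ≤ r)
    (h : ∀ z, pairing z v ≤ C z * r) : v ∈ r • convexHull ℝ (Set.range torusPoint) := by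
  by_contra hv
  obtain ⟨f, u, hf, hu⟩ := geometric_hahn_banach_closed_point
    ((convex_convexHull ℝ (Set.range torusPoint)).smul r)
    ((isCompact_convexHull_of_finiteDimensional isCompact_range_torusPoint).smul r).isClosed hv
  obtain ⟨z, hz⟩ := exists_pairing_eq f
  have hlt (t : ℝ × ℝ × ℝ) : r * pairing z (torusPoint t) < u := by
    rw [← pairing_smul, ← hz]
    exact hf _ (Set.smul_mem_smul_set (subset_convexHull ℝ _ ⟨t, rfl⟩))
  refine absurd (h z) (not_le.mpr ?_)
  rw [← hz]
  refine lt_of_le_of_lt ?_ hu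
  rw [C_eq, Real.iSup_mul_of_nonneg hr]
  refine ciSup_le fun t => ?_
  have hmul : |pairing z (torusPoint t)| * r = |r * pairing z (torusPoint t)| := by
    rw [abs_mul, abs_of_nonneg hr, mul_comm]
  rw [hmul, abs_le']
  constructor
  · exact (hlt t).le
  · have := hlt (t.1 + Real.pi, t.2.1 + Real.pi, t.2.2 - Real.pi)
    rw [torusPoint_add_pi, ← neg_one_smul ℝ, pairing_smul] at this
    linarith

/-! ### Torus points as anti-diagonals of separable matrices -/

lemma diagonalEntry_add (a a' b b' : Fin 4 → ℝ) (i j k : Fin 2) :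
    diagonalEntry (a + a') (b + b') i j k = diagonalEntry a b i j k + diagonalEntry a' b' i j k := by
  revert i j k
  simp [Fin.forall_fin_two, diagonalEntry]

lemma diagonalEntry_smul (r : ℝ) (a b : Fin 4 → ℝ) (i j k : Fin 2) :
    diagonalEntry (r • a) (r • b) i j k = r * diagonalEntry a b i j k := by
  revert i j k
  simp [Fin.forall_fin_two, diagonalEntry]

lemma antidiagonalEntry_add (c c' : Fin 4 → ℂ) (i j k : Fin 2) :
    antidiagonalEntry (c + c') i j k = antidiagonalEntry c i j k + antidiagonalEntry c' i j k := by
  revert i j k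
  simp [Fin.forall_fin_two, antidiagonalEntry]

lemma antidiagonalEntry_smul (r : ℝ) (c : Fin 4 → ℂ) (i j k : Fin 2) :
    antidiagonalEntry (r • c) i j k = r * antidiagonalEntry c i j k := by
  revert i j k
  simp [Fin.forall_fin_two, antidiagonalEntry]

lemma X_add (a a' b b' : Fin 4 → ℝ) (c c' : Fin 4 → ℂ) :
    X (a + a') (b + b') (c + c') = X a b c + X a' b' c' := by
  ext ⟨i, j, k⟩ ⟨i', j', k'⟩
  simp only [Matrix.add_apply, X_apply, diagonalEntry_add, antidiagonalEntry_add]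
  split_ifs <;> simp

lemma X_smul (r : ℝ) (a b : Fin 4 → ℝ) (c : Fin 4 → ℂ) :
    X (r • a) (r • b) (r • c) = r • X a b c := by
  ext ⟨i, j, k⟩ ⟨i', j', k'⟩
  simp only [Matrix.smul_apply, X_apply, diagonalEntry_smul, antidiagonalEntry_smul]
  split_ifs <;> simp

/-- Conjugation of the last coordinate. -/
def conjLast (v : Fin 4 → ℂ) : Fin 4 → ℂ := ![v 0, v 1, v 2, star (v 3)]

lemma conjLast_conjLast (v : Fin 4 → ℂ) : conjLast (conjLast v) = v := by
  ext i
  fin_cases i <;> simp [conjLast]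

lemma conjLast_add (v w : Fin 4 → ℂ) : conjLast (v + w) = conjLast v + conjLast w := by
  ext i
  fin_cases i <;> simp [conjLast]

lemma conjLast_smul (r : ℝ) (v : Fin 4 → ℂ) : conjLast (r • v) = r • conjLast v := by
  ext i
  fin_cases i <;> simp [conjLast]

/-- The qubit vector with `x₀ x̄₁ = e^{iθ}` and `|x₀|² = e^u = |x₁|⁻²`. -/
noncomputable def qubit (u θ : ℝ) : Fin 2 → ℂ :=
  ![exp ((u + θ * I) / 2), exp (-((u + θ * I) / 2))]

lemma normSq_qubit_zero (u θ : ℝ) : normSq (qubit u θ 0) = Real.exp u := by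
  rw [normSq_eq_norm_sq]
  simp [qubit, norm_exp, ← Real.exp_nat_mul]
  ring

lemma normSq_qubit_one (u θ : ℝ) : normSq (qubit u θ 1) = Real.exp (-u) := by
  rw [normSq_eq_norm_sq]
  simp [qubit, norm_exp, ← Real.exp_nat_mul]
  ring

lemma qubit_mul_star (u θ : ℝ) : qubit u θ 0 * star (qubit u θ 1) = exp (θ * I) := by
  simp only [qubit, star_def, Matrix.cons_val_zero, Matrix.cons_val_one, ← exp_conj, ← exp_add]
  congr 1
  simp [map_ofNat (starRingEnd ℂ) 2]
  ring

lemma qubit_mul_star' (u θ : ℝ) : qubit u θ 1 * star (qubit u θ 0) = exp (-(θ * I)) := by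
  simp only [qubit, star_def, Matrix.cons_val_zero, Matrix.cons_val_one, ← exp_conj, ← exp_add]
  congr 1
  simp [map_ofNat (starRingEnd ℂ) 2]
  ring

/-- The qubit phases solve θ₁+θ₂+θ₃ = α+β+γ, θ₁+θ₂-θ₃ = α, θ₁-θ₂+θ₃ = β, θ₁-θ₂-θ₃ = -γ; the last
sign is why `conjLast` appears. The moduli solve the same system with right-hand side s, which is
consistent exactly when s is balanced. -/
lemma X_torusPoint_mem_sepCone {s : Fin 4 → ℝ} (hs : s 0 + s 3 = s 1 + s 2) (t : ℝ × ℝ × ℝ) :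
    X (fun i => Real.exp (s i)) (fun i => Real.exp (-s i)) (conjLast (torusPoint t)) ∈ sepCone := by
  convert X_mem_sepCone_of_product (qubit ((s 0 + s 3) / 2) ((t.1 + t.2.1) / 2))
    (qubit ((s 0 - s 2) / 2) ((t.1 + t.2.2) / 2))
    (qubit ((s 0 - s 1) / 2) ((t.2.1 + t.2.2) / 2)) using 2
  · ext i
    simp only [normSq_qubit_zero, normSq_qubit_one, ← Real.exp_add]
    fin_cases i <;> simp <;> linarith
  · ext i
    simp only [normSq_qubit_zero, normSq_qubit_one, ← Real.exp_add]
    fin_cases i <;> simp <;> linarith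
  · ext i
    simp only [qubit_mul_star, qubit_mul_star', ← exp_add]
    fin_cases i <;> simp [conjLast, torusPoint, ← exp_conj] <;> congr 1 <;> ring

/-- The larger of the two lower sums serves as common value `S` of both pair sums; each pair of
intervals can then be made to add up to `S`. -/
lemma exists_balanced_between {l h : Fin 4 → ℝ} (hlh : ∀ i, l i ≤ h i)
    (h₁ : l 0 + l 3 ≤ h 1 + h 2) (h₂ : l 1 + l 2 ≤ h 0 + h 3) :
    ∃ s : Fin 4 → ℝ, (∀ i, l i ≤ s i ∧ s i ≤ h i) ∧ s 0 + s 3 = s 1 + s 2 := by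
  have h0 := hlh 0
  have h1 := hlh 1
  have h2 := hlh 2
  have h3 := hlh 3
  set S := max (l 0 + l 3) (l 1 + l 2)
  have hS₁ : l 0 + l 3 ≤ S := le_max_left _ _
  have hS₂ : l 1 + l 2 ≤ S := le_max_right _ _
  have hS₃ : S ≤ h 0 + h 3 := max_le (by linarith) h₂
  have hS₄ : S ≤ h 1 + h 2 := max_le h₁ (by linarith)
  have split (p q p' q' : ℝ) (hp : p ≤ p') (hq : q ≤ q') (hl : p + q ≤ S) (hu : S ≤ p' + q') :
      ∃ x, (p ≤ x ∧ x ≤ p') ∧ q ≤ S - x ∧ S - x ≤ q' := by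
    rcases le_total p' (S - q) with hle | hle
    · exact ⟨p', ⟨hp, le_rfl⟩, by linarith, by linarith⟩
    · exact ⟨S - q, ⟨by linarith, hle⟩, by linarith, by linarith⟩
  obtain ⟨x, hx, hx'⟩ := split _ _ _ _ h0 h3 hS₁ hS₃
  obtain ⟨y, hy, hy'⟩ := split _ _ _ _ h1 h2 hS₂ hS₄
  refine ⟨![x, y, S - y, S - x], fun i => ?_, by simp⟩
  fin_cases i
  exacts [hx, hy, hy', hx']

/-! ### Geometric-mean bounds -/

/-- The bounds that characterise the numbers `0 ≤ m ≤ Delta a b`. -/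
structure GeomBound (a b : Fin 4 → ℝ) (m : ℝ) : Prop where
  nonneg : 0 ≤ m
  left_nonneg : ∀ i, 0 ≤ a i
  right_nonneg : ∀ i, 0 ≤ b i
  sq_le : ∀ i, m ^ 2 ≤ a i * b i
  pow_four_le : m ^ 4 ≤ a 0 * b 1 * b 2 * a 3
  pow_four_le' : m ^ 4 ≤ b 0 * a 1 * a 2 * b 3

lemma le_Delta_iff {a b : Fin 4 → ℝ} (ha : ∀ i, 0 ≤ a i) (hb : ∀ i, 0 ≤ b i) {m : ℝ}
    (hm : 0 ≤ m) : m ≤ Delta a b ↔ (∀ i, m ^ 2 ≤ a i * b i) ∧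
      m ^ 4 ≤ a 0 * b 1 * b 2 * a 3 ∧ m ^ 4 ≤ b 0 * a 1 * a 2 * b 3 := by
  have hroot (x : ℝ) (hx : 0 ≤ x) : m ≤ x ^ (1 / 4 : ℝ) ↔ m ^ 4 ≤ x := by
    rw [one_div, Real.le_rpow_inv_iff_of_pos hm hx (by norm_num)]
    norm_cast
  have hA : 0 ≤ a 0 * b 1 * b 2 * a 3 :=
    mul_nonneg (mul_nonneg (mul_nonneg (ha 0) (hb 1)) (hb 2)) (ha 3)
  have hB : 0 ≤ b 0 * a 1 * a 2 * b 3 :=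
    mul_nonneg (mul_nonneg (mul_nonneg (hb 0) (ha 1)) (ha 2)) (hb 3)
  rw [Delta, le_min_iff, le_min_iff, hroot _ hA, hroot _ hB,
    le_ciInf_iff (Set.finite_range _).bddBelow,
    forall_congr' fun i => Real.le_sqrt hm (mul_nonneg (ha i) (hb i))]

lemma Delta_nonneg {a b : Fin 4 → ℝ} (ha : ∀ i, 0 ≤ a i) (hb : ∀ i, 0 ≤ b i) :
    0 ≤ Delta a b := by
  rw [le_Delta_iff ha hb le_rfl]
  refine ⟨fun i => ?_, ?_, ?_⟩
  · have := mul_nonneg (ha i) (hb i)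
    simpa
  · have := mul_nonneg (mul_nonneg (mul_nonneg (ha 0) (hb 1)) (hb 2)) (ha 3)
    simpa
  · have := mul_nonneg (mul_nonneg (mul_nonneg (hb 0) (ha 1)) (ha 2)) (hb 3)
    simpa

lemma geomBound_Delta {a b : Fin 4 → ℝ} (ha : ∀ i, 0 ≤ a i) (hb : ∀ i, 0 ≤ b i) :
    GeomBound a b (Delta a b) :=
  have h := (le_Delta_iff ha hb (Delta_nonneg ha hb)).mp le_rfl
  ⟨Delta_nonneg ha hb, ha, hb, h.1, h.2.1, h.2.2⟩

/-- After taking logarithms, sᵢ must lie in [log m - log bᵢ, log aᵢ - log m]. The quadratic bounds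
make these intervals nonempty, and the two quartic bounds are the cross conditions of
`exists_balanced_between`. -/
lemma GeomBound.exists_exponents {a b : Fin 4 → ℝ} {m : ℝ} (h : GeomBound a b m) (hm : 0 < m) :
    ∃ s : Fin 4 → ℝ, s 0 + s 3 = s 1 + s 2 ∧
      (∀ i, m * Real.exp (s i) ≤ a i) ∧ ∀ i, m * Real.exp (-s i) ≤ b i := by
  have hab (i : Fin 4) : 0 < a i * b i := (pow_pos hm 2).trans_le (h.sq_le i)
  have ha (i : Fin 4) : 0 < a i := (h.left_nonneg i).lt_of_ne' (left_ne_zero_of_mul (hab i).ne')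
  have hb (i : Fin 4) : 0 < b i := (h.right_nonneg i).lt_of_ne' (right_ne_zero_of_mul (hab i).ne')
  have ha0 (i : Fin 4) := (ha i).ne'
  have hb0 (i : Fin 4) := (hb i).ne'
  obtain ⟨s, hs, hbal⟩ := exists_balanced_between (l := fun i => Real.log m - Real.log (b i))
    (h := fun i => Real.log (a i) - Real.log m) (fun i => by
      have := Real.log_le_log (by positivity) (h.sq_le i)
      rw [Real.log_pow, Real.log_mul (ha0 i) (hb0 i)] at this
      push_cast at this
      linarith) (by
      have := Real.log_le_log (by positivity) h.pow_four_le'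
      rw [Real.log_pow, Real.log_mul (by simp [ha0, hb0]) (hb0 3),
        Real.log_mul (by simp [ha0, hb0]) (ha0 2), Real.log_mul (hb0 0) (ha0 1)] at this
      push_cast at this
      linarith) (by
      have := Real.log_le_log (by positivity) h.pow_four_le
      rw [Real.log_pow, Real.log_mul (by simp [ha0, hb0]) (ha0 3),
        Real.log_mul (by simp [ha0, hb0]) (hb0 2), Real.log_mul (ha0 0) (hb0 1)] at this
      push_cast at this
      linarith)
  refine ⟨s, hbal, fun i => ?_, fun i => ?_⟩
  · rw [← Real.exp_log hm, ← Real.exp_add, ← Real.le_log_iff_exp_le (ha i)]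
    linarith [(hs i).2]
  · rw [← Real.exp_log hm, ← Real.exp_add, ← Real.le_log_iff_exp_le (hb i)]
    linarith [(hs i).1]

lemma convex_X_mem_sepCone (a b : Fin 4 → ℝ) :
    Convex ℝ {v : Fin 4 → ℂ | X a b (conjLast v) ∈ sepCone} := by
  intro v hv w hw s t hs ht hst
  have h : X a b (conjLast (s • v + t • w)) =
      s • X a b (conjLast v) + t • X a b (conjLast w) := by
    rw [← X_smul, ← X_smul, ← X_add, ← add_smul, ← add_smul, hst, one_smul, one_smul,
      conjLast_add, conjLast_smul, conjLast_smul]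
  change X a b _ ∈ sepCone
  rw [h]
  exact add_mem (smul_mem_sepCone hs hv) (smul_mem_sepCone ht hw)

lemma GeomBound.X_mem_sepCone {a b : Fin 4 → ℝ} {m : ℝ} (h : GeomBound a b m) {v : Fin 4 → ℂ}
    (hv : v ∈ convexHull ℝ (Set.range torusPoint)) : X a b (conjLast (m • v)) ∈ sepCone := by
  -- For m = 0 the logarithms are unavailable, but only a diagonal matrix remains.
  rcases h.nonneg.eq_or_lt with rfl | hm
  · have : conjLast ((0 : ℝ) • v) = 0 := by rw [conjLast_smul, zero_smul]
    rw [this]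
    exact X_diagonal_mem_sepCone h.left_nonneg h.right_nonneg
  obtain ⟨s, hs, ha, hb⟩ := h.exists_exponents hm
  have hcore : X (fun i => Real.exp (s i)) (fun i => Real.exp (-s i)) (conjLast v) ∈ sepCone := by
    refine convexHull_min ?_ (convex_X_mem_sepCone _ _) hv
    rintro _ ⟨t, rfl⟩
    exact X_torusPoint_mem_sepCone hs t
  have hdiag := X_diagonal_mem_sepCone (a := a - m • fun i => Real.exp (s i))
    (b := b - m • fun i => Real.exp (-s i)) (fun i => sub_nonneg.mpr (ha i))
    (fun i => sub_nonneg.mpr (hb i))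
  have hsum := add_mem (smul_mem_sepCone hm.le hcore) hdiag
  rwa [← X_smul, ← X_add, add_sub_cancel, add_sub_cancel, add_zero, ← conjLast_smul] at hsum

/-! ### Superadditivity and necessity -/

/-- Only the cross term matters: (mn)² ≤ (xy')(x'y), so 2mn ≤ xy' + x'y by the arithmetic–geometric
mean inequality. -/
lemma sq_add_le_of_sq_le {m n x y x' y' : ℝ} (hx : 0 ≤ x) (hy : 0 ≤ y)
    (hx' : 0 ≤ x') (hy' : 0 ≤ y') (h : m ^ 2 ≤ x * y) (h' : n ^ 2 ≤ x' * y') :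
    (m + n) ^ 2 ≤ (x + x') * (y + y') := by
  have h1 : (m * n) ^ 2 ≤ (x * y') * (x' * y) := by
    calc (m * n) ^ 2 = m ^ 2 * n ^ 2 := by ring
      _ ≤ (x * y) * (x' * y') := by gcongr
      _ = _ := by ring
  have h2 : (2 * (m * n)) ^ 2 ≤ (x * y' + x' * y) ^ 2 := by
    nlinarith [sq_nonneg (x * y' - x' * y)]
  have h3 := abs_le_of_sq_le_sq h2 (by positivity)
  nlinarith [h3, le_abs_self (2 * (m * n))]

/-- The two-factor case is applied to (x, y), to (z, w), and to the resulting square roots. -/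
lemma pow_four_add_le_of_pow_four_le {m n x y z w x' y' z' w' : ℝ}
    (hx : 0 ≤ x) (hy : 0 ≤ y) (hz : 0 ≤ z) (hw : 0 ≤ w)
    (hx' : 0 ≤ x') (hy' : 0 ≤ y') (hz' : 0 ≤ z') (hw' : 0 ≤ w')
    (h : m ^ 4 ≤ x * y * z * w) (h' : n ^ 4 ≤ x' * y' * z' * w') :
    (m + n) ^ 4 ≤ (x + x') * (y + y') * (z + z') * (w + w') := by
  have key {m x y z w : ℝ} (hx : 0 ≤ x) (hy : 0 ≤ y) (hz : 0 ≤ z) (hw : 0 ≤ w)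
      (h : m ^ 4 ≤ x * y * z * w) : m ^ 2 ≤ √(x * y) * √(z * w) := by
    rw [← Real.sqrt_mul (by positivity)]
    exact Real.le_sqrt_of_sq_le (by linarith [h])
  have hs {x y : ℝ} (hx : 0 ≤ x) (hy : 0 ≤ y) : √(x * y) ^ 2 ≤ x * y :=
    (Real.sq_sqrt (mul_nonneg hx hy)).le
  have h1 := sq_add_le_of_sq_le hx hy hx' hy' (hs hx hy) (hs hx' hy')
  have h2 := sq_add_le_of_sq_le hz hw hz' hw' (hs hz hw) (hs hz' hw')
  have h3 := sq_add_le_of_sq_le (Real.sqrt_nonneg _) (Real.sqrt_nonneg _) (Real.sqrt_nonneg _)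
    (Real.sqrt_nonneg _) (key hx hy hz hw h) (key hx' hy' hz' hw' h')
  calc (m + n) ^ 4 = ((m + n) ^ 2) ^ 2 := by ring
    _ ≤ ((√(x * y) + √(x' * y')) * (√(z * w) + √(z' * w'))) ^ 2 := by gcongr
    _ = (√(x * y) + √(x' * y')) ^ 2 * (√(z * w) + √(z' * w')) ^ 2 := by ring
    _ ≤ ((x + x') * (y + y')) * ((z + z') * (w + w')) := by gcongr
    _ = _ := by ring

lemma GeomBound.add {a b a' b' : Fin 4 → ℝ} {m n : ℝ} (h : GeomBound a b m)
    (h' : GeomBound a' b' n) : GeomBound (a + a') (b + b') (m + n) where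
  nonneg := add_nonneg h.nonneg h'.nonneg
  left_nonneg i := add_nonneg (h.left_nonneg i) (h'.left_nonneg i)
  right_nonneg i := add_nonneg (h.right_nonneg i) (h'.right_nonneg i)
  sq_le i := sq_add_le_of_sq_le (h.left_nonneg i) (h.right_nonneg i) (h'.left_nonneg i)
    (h'.right_nonneg i) (h.sq_le i) (h'.sq_le i)
  pow_four_le := pow_four_add_le_of_pow_four_le (h.left_nonneg _)
    (h.right_nonneg _) (h.right_nonneg _) (h.left_nonneg _) (h'.left_nonneg _)
    (h'.right_nonneg _) (h'.right_nonneg _) (h'.left_nonneg _) h.pow_four_le h'.pow_four_le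
  pow_four_le' := pow_four_add_le_of_pow_four_le (h.right_nonneg _)
    (h.left_nonneg _) (h.left_nonneg _) (h.right_nonneg _) (h'.right_nonneg _)
    (h'.left_nonneg _) (h'.left_nonneg _) (h'.right_nonneg _) h.pow_four_le' h'.pow_four_le'

lemma GeomBound.smul {a b : Fin 4 → ℝ} {m r : ℝ} (h : GeomBound a b m) (hr : 0 ≤ r) :
    GeomBound (r • a) (r • b) (r * m) where
  nonneg := mul_nonneg hr h.nonneg
  left_nonneg i := mul_nonneg hr (h.left_nonneg i)
  right_nonneg i := mul_nonneg hr (h.right_nonneg i)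
  sq_le i := by
    have := mul_le_mul_of_nonneg_left (h.sq_le i) (pow_nonneg hr 2)
    simp only [Pi.smul_apply, smul_eq_mul]
    linarith
  pow_four_le := by
    have := mul_le_mul_of_nonneg_left h.pow_four_le (pow_nonneg hr 4)
    simp only [Pi.smul_apply, smul_eq_mul]
    linarith
  pow_four_le' := by
    have := mul_le_mul_of_nonneg_left h.pow_four_le' (pow_nonneg hr 4)
    simp only [Pi.smul_apply, smul_eq_mul]
    linarith

/-- The upper half of the diagonal of a three-qubit matrix. -/
def upperDiagonal (M : Matrix Idx Idx ℂ) : Fin 4 → ℝ :=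
  ![(M (0, 0, 0) (0, 0, 0)).re, (M (0, 0, 1) (0, 0, 1)).re,
    (M (0, 1, 0) (0, 1, 0)).re, (M (0, 1, 1) (0, 1, 1)).re]

/-- The lower half of the diagonal of a three-qubit matrix, read upwards. -/
def lowerDiagonal (M : Matrix Idx Idx ℂ) : Fin 4 → ℝ :=
  ![(M (1, 1, 1) (1, 1, 1)).re, (M (1, 1, 0) (1, 1, 0)).re,
    (M (1, 0, 1) (1, 0, 1)).re, (M (1, 0, 0) (1, 0, 0)).re]

/-- The upper half of the anti-diagonal of a three-qubit matrix. -/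
def upperAntidiagonal (M : Matrix Idx Idx ℂ) : Fin 4 → ℂ :=
  ![M (0, 0, 0) (1, 1, 1), M (0, 0, 1) (1, 1, 0), M (0, 1, 0) (1, 0, 1), M (0, 1, 1) (1, 0, 0)]

lemma upperDiagonal_combo (M N : Matrix Idx Idx ℂ) (s t : ℝ) :
    upperDiagonal (s • M + t • N) = s • upperDiagonal M + t • upperDiagonal N := by
  ext i
  fin_cases i <;> simp [upperDiagonal]

lemma lowerDiagonal_combo (M N : Matrix Idx Idx ℂ) (s t : ℝ) :
    lowerDiagonal (s • M + t • N) = s • lowerDiagonal M + t • lowerDiagonal N := by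
  ext i
  fin_cases i <;> simp [lowerDiagonal]

lemma upperAntidiagonal_combo (M N : Matrix Idx Idx ℂ) (s t : ℝ) :
    upperAntidiagonal (s • M + t • N) = s • upperAntidiagonal M + t • upperAntidiagonal N := by
  ext i
  fin_cases i <;> simp [upperAntidiagonal]

/-- The matrices whose X-part satisfies the separability bounds for some common value `m`. -/
def xBoundSet : Set (Matrix Idx Idx ℂ) :=
  {M | ∃ m, GeomBound (upperDiagonal M) (lowerDiagonal M) m ∧
    ∀ z, pairing z (conjLast (upperAntidiagonal M)) ≤ C z * m}

lemma convex_xBoundSet : Convex ℝ xBoundSet := by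
  rintro M ⟨m, hm, hM⟩ N ⟨n, hn, hN⟩ s t hs ht -
  refine ⟨s * m + t * n, ?_, fun z => ?_⟩
  · rw [upperDiagonal_combo, lowerDiagonal_combo]
    exact (hm.smul hs).add (hn.smul ht)
  · rw [upperAntidiagonal_combo, conjLast_add, conjLast_smul, conjLast_smul, pairing_add,
      pairing_smul, pairing_smul]
    linarith [mul_le_mul_of_nonneg_left (hM z) hs, mul_le_mul_of_nonneg_left (hN z) ht]

lemma star_ofReal (r : ℝ) : star (r : ℂ) = r := conj_ofReal r

lemma star_exp_ofReal_mul_I (θ : ℝ) : star (exp (θ * I)) = exp (-(θ * I)) := by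
  rw [star_def, ← exp_conj]
  simp

lemma star_exp_neg_ofReal_mul_I (θ : ℝ) : star (exp (-(θ * I))) = exp (θ * I) := by
  rw [← star_exp_ofReal_mul_I, star_star]

lemma mul_star_eq (x y : ℂ) : ∃ θ : ℝ, x * star y = (‖x‖ * ‖y‖ : ℝ) * exp (θ * I) ∧
    y * star x = (‖x‖ * ‖y‖ : ℝ) * exp (-(θ * I)) := by
  have h : x * star y = (‖x‖ * ‖y‖ : ℝ) * exp ((x * star y).arg * I) := by
    conv_lhs => rw [← norm_mul_exp_arg_mul_I (x * star y)]
    simp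
  refine ⟨_, h, ?_⟩
  have h' := congrArg star h
  rw [star_mul', star_star, mul_comm] at h'
  rw [h', star_mul', star_ofReal, star_exp_ofReal_mul_I]

/-- The common value m is the product of all six moduli, and the five product bounds in fact between
squares and fourth powers are equalities, since each product contains every modulus equally often.
-/
lemma kronecker_ketbra_mem_xBoundSet (x y z : Fin 2 → ℂ) :
    ketbra x ⊗ₖ (ketbra y ⊗ₖ ketbra z) ∈ xBoundSet := by
  obtain ⟨α, hα, -⟩ := mul_star_eq (x 0) (x 1)
  obtain ⟨β, hβ, hβ'⟩ := mul_star_eq (y 0) (y 1)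
  obtain ⟨γ, hγ, hγ'⟩ := mul_star_eq (z 0) (z 1)
  have hentry (i j k i' j' k' : Fin 2) :
      (ketbra x ⊗ₖ (ketbra y ⊗ₖ ketbra z)) (i, j, k) (i', j', k') =
        x i * star (x i') * (y j * star (y j') * (z k * star (z k'))) := rfl
  have hdiag (i j k : Fin 2) :
      ((ketbra x ⊗ₖ (ketbra y ⊗ₖ ketbra z)) (i, j, k) (i, j, k)).re =
        ‖x i‖ ^ 2 * (‖y j‖ ^ 2 * ‖z k‖ ^ 2) := by
    rw [hentry]
    simp only [star_def, mul_conj, ← ofReal_mul, ofReal_re, normSq_eq_norm_sq]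
  have hanti : conjLast (upperAntidiagonal (ketbra x ⊗ₖ (ketbra y ⊗ₖ ketbra z))) =
      ((‖x 0‖ * ‖x 1‖) * ((‖y 0‖ * ‖y 1‖) * (‖z 0‖ * ‖z 1‖))) •
        torusPoint (α + β - γ, α - β + γ, -α + β + γ) := by
    have he (p q r : ℝ) (u v w t : ℂ) (h : u + v + w = t) :
        (p : ℂ) * exp u * (q * exp v * (r * exp w)) = (p * (q * r) : ℝ) * exp t := by
      rw [← h, exp_add, exp_add]
      push_cast
      ring
    ext i
    fin_cases i <;>
      simp only [conjLast, upperAntidiagonal, torusPoint, hentry, Pi.smul_apply, real_smul,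
        Matrix.cons_val, Fin.zero_eta, Fin.mk_one, Fin.reduceFinMk, star_mul',
        hα, hβ, hβ', hγ, hγ', star_ofReal, star_exp_ofReal_mul_I, star_exp_neg_ofReal_mul_I] <;>
      refine he _ _ _ _ _ _ _ ?_ <;> push_cast <;> ring
  refine ⟨(‖x 0‖ * ‖x 1‖) * ((‖y 0‖ * ‖y 1‖) * (‖z 0‖ * ‖z 1‖)),
    ⟨by positivity, ?_, ?_, ?_, ?_, ?_⟩, fun ζ => ?_⟩
  · intro i
    fin_cases i <;> simp only [upperDiagonal, hdiag, Matrix.cons_val, Fin.zero_eta, Fin.mk_one,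
      Fin.reduceFinMk] <;> positivity
  · intro i
    fin_cases i <;> simp only [lowerDiagonal, hdiag, Matrix.cons_val, Fin.zero_eta, Fin.mk_one,
      Fin.reduceFinMk] <;> positivity
  · intro i
    fin_cases i <;> simp only [upperDiagonal, lowerDiagonal, hdiag, Matrix.cons_val, Fin.zero_eta,
      Fin.mk_one, Fin.reduceFinMk] <;> apply le_of_eq <;> ring
  · simp only [upperDiagonal, lowerDiagonal, hdiag, Matrix.cons_val]
    apply le_of_eq
    ring
  · simp only [upperDiagonal, lowerDiagonal, hdiag, Matrix.cons_val]
    apply le_of_eq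
    ring
  · rw [hanti, pairing_smul, mul_comm]
    gcongr
    exact (le_abs_self _).trans (abs_pairing_le_C _ _)

lemma convexHull_pureProductStates_subset : convexHull ℝ pureProductStates ⊆ xBoundSet := by
  refine convexHull_min ?_ convex_xBoundSet
  rintro _ ⟨_, _, _, ⟨x, -, rfl⟩, ⟨y, -, rfl⟩, ⟨z, -, rfl⟩, rfl⟩
  exact kronecker_ketbra_mem_xBoundSet x y z

lemma L_eq_pairing (c z : Fin 4 → ℂ) : L c z = pairing z (conjLast c) := by
  simp [L, pairing, conjLast, Fin.sum_univ_four]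

lemma upperDiagonal_X (a b : Fin 4 → ℝ) (c : Fin 4 → ℂ) : upperDiagonal (X a b c) = a := by
  ext i
  fin_cases i <;> simp [upperDiagonal, X_apply, diagonalEntry]

lemma lowerDiagonal_X (a b : Fin 4 → ℝ) (c : Fin 4 → ℂ) : lowerDiagonal (X a b c) = b := by
  ext i
  fin_cases i <;> simp [lowerDiagonal, X_apply, diagonalEntry]

lemma upperAntidiagonal_X (a b : Fin 4 → ℝ) (c : Fin 4 → ℂ) :
    upperAntidiagonal (X a b c) = c := by
  ext i
  fin_cases i <;> simp [upperAntidiagonal, X_apply, antidiagonalEntry]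

lemma C_nonneg (z : Fin 4 → ℂ) : 0 ≤ C z :=
  (abs_nonneg _).trans (abs_pairing_le_C z 0)

lemma X_diagonal_nonneg {a b : Fin 4 → ℝ} {c : Fin 4 → ℂ} (h : (X a b c).PosSemidef) :
    (∀ i, 0 ≤ a i) ∧ ∀ i, 0 ≤ b i := by
  have hd (p : Idx) : 0 ≤ (X a b c p p).re := (Complex.le_def.mp (h.diag_nonneg (i := p))).1
  constructor
  · rw [← upperDiagonal_X a b c]
    intro i
    fin_cases i <;> exact hd _
  · rw [← lowerDiagonal_X a b c]
    intro i
    fin_cases i <;> exact hd _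

end ThreeQubit


theorem theorem2p1 (a b : Fin 4 → ℝ) (c : Fin 4 → ℂ)
    (hρ : ThreeQubit.IsState (ThreeQubit.X a b c)) :
    ThreeQubit.IsSeparable (ThreeQubit.X a b c) ↔
      ∀ z : Fin 4 → ℂ, ThreeQubit.C z * ThreeQubit.Delta a b ≥ ThreeQubit.L c z := by
  obtain ⟨ha, hb⟩ := ThreeQubit.X_diagonal_nonneg hρ.1
  constructor
  · intro h z
    obtain ⟨m, hm, hL⟩ := ThreeQubit.convexHull_pureProductStates_subset h
    rw [ThreeQubit.upperDiagonal_X, ThreeQubit.lowerDiagonal_X] at hm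
    rw [ThreeQubit.upperAntidiagonal_X] at hL
    rw [ThreeQubit.L_eq_pairing]
    -- The witness m of the hull element need not be Δ, but it is at most Δ, and C(z) ≥ 0.
    exact (hL z).trans (mul_le_mul_of_nonneg_left
      ((ThreeQubit.le_Delta_iff ha hb hm.nonneg).mpr ⟨hm.sq_le, hm.pow_four_le, hm.pow_four_le'⟩)
      (ThreeQubit.C_nonneg z))
  · intro h
    obtain ⟨v, hv, hvc⟩ := ThreeQubit.mem_smul_convexHull_torus (ThreeQubit.Delta_nonneg ha hb)
      fun z => (ThreeQubit.L_eq_pairing c z).symm.trans_le (h z)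
    have hmem := (ThreeQubit.geomBound_Delta ha hb).X_mem_sepCone hv
    have hc : ThreeQubit.conjLast (ThreeQubit.Delta a b • v) = c :=
      (congrArg ThreeQubit.conjLast hvc).trans (ThreeQubit.conjLast_conjLast c)
    rw [hc] at hmem
    exact ThreeQubit.isSeparable_of_mem_sepCone hmem hρ.2
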